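/- Let $k$ be a field of characteristic $0$. A representation is a pair $(L,V)$ of a Lie algebra $L$ over $k$ and an $L$-module $V$, regarded as a two-sorted algebra (elements of $L$ are of sort $1$, elements of $V$ of sort $2$); a homomorphism $(L,V)\to(L',V')$ is a pair of a Lie algebra homomorphism and a linear map compatible with the actions. Fix countably infinite disjoint sets $X_0^{(1)},X_0^{(2)}$ of variables of sorts $1$ and $2$. For finite sets $X^{(i)}\subset X_0^{(i)}$ and $X=X^{(1)}\cup X^{(2)}$, the absolutely free representation $F(X)$ consists of the free Lie algebra $L(X^{(1)})$ and the free left module $A(X^{(1)})X^{(2)}$ with basis $X^{(2)}$ over the free associative unital algebra $A(X^{(1)})$, on which $L(X^{(1)})$ acts through the canonical map $L(X^{(1)})\to A(X^{(1)})$. Let $\Theta$ be a variety of representations, i.e. the class of all representations satisfying a given set of identities. Put $F_\Theta(X)=\bigl(L(X^{(1)})/I_\Theta(X^{(1)}),\ A(X^{(1)})X^{(2)}/V_\Theta(X)\bigr)$, where $I_\Theta(X^{(1)})$ and $V_\Theta(X)$ consist of those $w$ of sort $1$, respectively $2$, for which $w=0$ is an identity of $\Theta$. Let $\Theta^0$ be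 the category whose objects are the free representations $F_\Theta(X)$, one for each finite $X\subset X_0^{(1)}\cup X_0^{(2)}$, and whose morphisms are all homomorphisms. Suppose that $\Theta$ is of action type, i.e. $I_\Theta(X^{(1)})=\{0\}$ for every finite $X^{(1)}\subset X_0^{(1)}$, and nontrivial, i.e. the identity $x^{(2)}=0$ is not fulfilled in $\Theta$. Then for every automorphism $\Phi$ of the category $\Theta^0$ and all variables $x^{(1)}\in X_0^{(1)}$, $x^{(2)}\in X_0^{(2)}$, $$\Phi\bigl(F_\Theta(x^{(1)})\bigr)\cong F_\Theta(x^{(1)})\quad\text{and}\quad \Phi\bigl(F_\Theta(x^{(2)})\bigr)\cong F_\Theta(x^{(2)}).$$ In particular $\Phi$ cannot swap these two objects, even up to isomorphism: $\Phi(F_\Theta(x^{(1)}))\not\cong F_\Theta(x^{(2)})$ and $\Phi(F_\Theta(x^{(2)}))\not\cong F_\Theta(x^{(1)})$. -/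

import Mathlib

open CategoryTheory

universe u

/-- A representation of a Lie algebra over `k`, as a two-sorted algebra: `L` is the Lie algebra
(first sort), `V` is the vector space (second sort), and the action `l ∘ v` is `⁅l, v⁆`. -/
structure LieRepr (k : Type u) [Field k] : Type (u + 1) where
  L : Type u
  V : Type u
  [lieRing : LieRing L]
  [lieAlgebra : LieAlgebra k L]
  [addCommGroup : AddCommGroup V]
  [module : Module k V]
  [lieRingModule : LieRingModule L V]
  [lieModule : LieModule k L V]

namespace LieRepr

attribute [instance] lieRing lieAlgebra addCommGroup module lieRingModule lieModule

variable {k : Type u} [Field k]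

/-- A homomorphism of two-sorted algebras: a homomorphism of Lie algebras and a linear map which
together respect the action. -/
@[ext]
structure Hom (H K : LieRepr k) where
  onL : H.L →ₗ⁅k⁆ K.L
  onV : H.V →ₗ[k] K.V
  map_act : ∀ (l : H.L) (v : H.V), onV ⁅l, v⁆ = ⁅onL l, onV v⁆

instance : Category (LieRepr k) where
  Hom H K := Hom H K
  id H := { onL := LieHom.id, onV := LinearMap.id, map_act := fun _ _ => rfl }
  comp f g :=
    { onL := g.onL.comp f.onL
      onV := g.onV.comp f.onV
      map_act := fun l v => by simp [f.map_act, g.map_act] }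

end LieRepr

section FreeRepresentation

variable (k : Type u) [Field k] (X₁ X₂ : Type)

attribute [local instance 100] LieRing.ofAssociativeRing

/-- The canonical homomorphism `ι : L(X₁) → A(X₁)` from the free Lie algebra to the free
associative algebra with unit, identical on the generators. -/
noncomputable def freeLieToAssoc : FreeLieAlgebra k X₁ →ₗ⁅k⁆ FreeAlgebra k X₁ :=
  FreeLieAlgebra.lift k (FreeAlgebra.ι k)

/-- The free left `A(X₁)`-module `A(X₁) X₂` with basis `X₂`. -/
abbrev FreeVec : Type u := X₂ →₀ FreeAlgebra k X₁

/-- `L(X₁)` acts on `A(X₁) X₂` by `l ∘ v = ι(l) v`. -/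
noncomputable instance FreeVec.instLieRingModule :
    LieRingModule (FreeLieAlgebra k X₁) (FreeVec k X₁ X₂) where
  bracket l v := freeLieToAssoc k X₁ l • v
  add_lie l m v := by
    change freeLieToAssoc k X₁ (l + m) • v = _ • v + _ • v
    rw [map_add, add_smul]
  lie_add l v w := smul_add _ v w
  leibniz_lie l m v := by
    change freeLieToAssoc k X₁ l • freeLieToAssoc k X₁ m • v
      = freeLieToAssoc k X₁ ⁅l, m⁆ • v + freeLieToAssoc k X₁ m • freeLieToAssoc k X₁ l • v
    rw [LieHom.map_lie, LieRing.of_associative_ring_bracket, sub_smul, mul_smul, mul_smul,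
      sub_add_cancel]

instance FreeVec.instLieModule : LieModule k (FreeLieAlgebra k X₁) (FreeVec k X₁ X₂) where
  smul_lie t l v := by
    change freeLieToAssoc k X₁ (t • l) • v = t • freeLieToAssoc k X₁ l • v
    rw [map_smul, smul_assoc]
  lie_smul t l v := by
    change freeLieToAssoc k X₁ l • t • v = t • freeLieToAssoc k X₁ l • v
    rw [smul_comm]

/-- The absolutely free representation `F(X)` generated by `X = X₁ ∪ X₂`. -/
noncomputable abbrev freeRepr : LieRepr k where
  L := FreeLieAlgebra k X₁
  V := FreeVec k X₁ X₂

end FreeRepresentation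

section Identities

variable {k : Type u} [Field k] {X₁ X₂ : Type}

/-- The identity `l = 0` (of the first sort, in the variables `X₁`) is fulfilled in `H`. -/
def HoldsL (H : LieRepr k) (l : FreeLieAlgebra k X₁) : Prop :=
  ∀ φ : FreeLieAlgebra k X₁ →ₗ⁅k⁆ H.L, φ l = 0

/-- The identity `v = 0` (of the second sort, in the variables `X₁ ∪ X₂`) is fulfilled in `H`. -/
def HoldsV (H : LieRepr k) (v : FreeVec k X₁ X₂) : Prop :=
  ∀ μ : freeRepr k X₁ X₂ ⟶ H, μ.onV v = 0

/-- `Θ` is a variety of representations: the class of all representations in which all the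
identities from some set are fulfilled. The variables of either sort are indexed by `ℕ`, and since
both sorts are abelian groups every identity can be written with right-hand side zero. -/
def IsVariety (Θ : Set (LieRepr k)) : Prop :=
  ∃ (E₁ : Set (FreeLieAlgebra k ℕ)) (E₂ : Set (FreeVec k ℕ ℕ)),
    ∀ H : LieRepr k, H ∈ Θ ↔ (∀ l ∈ E₁, HoldsL H l) ∧ (∀ v ∈ E₂, HoldsV H v)

variable (Θ : Set (LieRepr k)) (X₁ X₂)

/-- The ideal `I_Θ(X₁)` of `L(X₁)`: all the identities `l = 0` of `Θ` in the variables `X₁`. -/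
def identIdeal : LieIdeal k (FreeLieAlgebra k X₁) where
  carrier := {l | ∀ H ∈ Θ, HoldsL H l}
  zero_mem' _ _ φ := map_zero φ
  add_mem' ha hb H hH φ := by rw [map_add, ha H hH φ, hb H hH φ, add_zero]
  smul_mem' t _ ha H hH φ := by rw [map_smul, ha H hH φ, smul_zero]
  lie_mem ha H hH φ := by rw [LieHom.map_lie, ha H hH φ, lie_zero]

/-- The submodule `V_Θ(X)` of `A(X₁) X₂`: all the identities `v = 0` of `Θ` in the variables
`X = X₁ ∪ X₂`. -/
def identSubmodule : LieSubmodule k (FreeLieAlgebra k X₁) (FreeVec k X₁ X₂) where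
  carrier := {v | ∀ H ∈ Θ, HoldsV H v}
  zero_mem' _ _ μ := map_zero μ.onV
  add_mem' {a b} ha hb H hH μ :=
    (map_add μ.onV a b).trans ((congrArg₂ (· + ·) (ha H hH μ) (hb H hH μ)).trans (add_zero 0))
  smul_mem' t a ha H hH μ :=
    (map_smul μ.onV t a).trans ((congrArg (t • ·) (ha H hH μ)).trans (smul_zero t))
  lie_mem {l a} ha H hH μ :=
    (μ.map_act l a).trans ((congrArg (⁅μ.onL l, ·⁆) (ha H hH μ)).trans (lie_zero _))

theorem lie_mem_identSubmodule {l : FreeLieAlgebra k X₁} (hl : l ∈ identIdeal X₁ Θ)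
    (v : FreeVec k X₁ X₂) : ⁅l, v⁆ ∈ identSubmodule X₁ X₂ Θ := by
  intro H hH μ
  have h := μ.map_act l v
  rw [show μ.onL l = 0 from hl H hH μ.onL, zero_lie] at h
  exact h

/-- The action of `L(X₁)` on `A(X₁) X₂ / V_Θ(X)`, factored through `L(X₁) / I_Θ(X₁)`. -/
noncomputable def quotAction : (FreeLieAlgebra k X₁ ⧸ identIdeal X₁ Θ) →ₗ[k]
    Module.End k (FreeVec k X₁ X₂ ⧸ identSubmodule X₁ X₂ Θ) :=
  Submodule.liftQ (identIdeal X₁ Θ).toSubmodule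
    (LieModule.toEnd k (FreeLieAlgebra k X₁)
      (FreeVec k X₁ X₂ ⧸ identSubmodule X₁ X₂ Θ) : _ →ₗ[k] _)
    (by
      intro l hl
      ext1 v
      obtain ⟨v, rfl⟩ := LieSubmodule.Quotient.surjective_mk' _ v
      exact (LieSubmodule.Quotient.mk_eq_zero'
        (N := identSubmodule X₁ X₂ Θ)).2 (lie_mem_identSubmodule X₁ X₂ Θ hl v))

noncomputable instance quotLieRingModule : LieRingModule (FreeLieAlgebra k X₁ ⧸ identIdeal X₁ Θ)
    (FreeVec k X₁ X₂ ⧸ identSubmodule X₁ X₂ Θ) where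
  bracket l v := quotAction X₁ X₂ Θ l v
  add_lie l m v := by
    change quotAction X₁ X₂ Θ (l + m) v = _
    rw [map_add]; rfl
  lie_add l v w := map_add _ v w
  leibniz_lie l m v := by
    obtain ⟨l, rfl⟩ := LieSubmodule.Quotient.surjective_mk' _ l
    obtain ⟨m, rfl⟩ := LieSubmodule.Quotient.surjective_mk' _ m
    exact leibniz_lie l m v

instance quotLieModule : LieModule k (FreeLieAlgebra k X₁ ⧸ identIdeal X₁ Θ)
    (FreeVec k X₁ X₂ ⧸ identSubmodule X₁ X₂ Θ) where
  smul_lie t l v := by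
    change quotAction X₁ X₂ Θ (t • l) v = _
    rw [map_smul]; rfl
  lie_smul t l v := map_smul _ t v

/-- The free representation `F_Θ(X) = F(X) / Id_Θ(X)` of `Θ` generated by `X = X₁ ∪ X₂`. -/
noncomputable abbrev relFreeRepr : LieRepr k where
  L := FreeLieAlgebra k X₁ ⧸ identIdeal X₁ Θ
  V := FreeVec k X₁ X₂ ⧸ identSubmodule X₁ X₂ Θ

end Identities

section Category

variable {k : Type u} [Field k] (Θ : Set (LieRepr k))

/-- The category `Θ⁰`. An object is a pair `X = (X₁, X₂)` of finite sets of variables, standing for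
the free representation `F_Θ(X)`; the morphisms are all homomorphisms `F_Θ(X) → F_Θ(Y)`. -/
abbrev FreeCat : Type :=
  InducedCategory (LieRepr k)
    (fun X : Finset ℕ × Finset ℕ => relFreeRepr (↥X.1) (↥X.2) Θ)

/-- `F_Θ(x)` for the variable `x` of the first sort. -/
def freeOnL (x : ℕ) : FreeCat Θ := (({x}, ∅) : Finset ℕ × Finset ℕ)

/-- `F_Θ(x)` for the variable `x` of the second sort. -/
def freeOnV (x : ℕ) : FreeCat Θ := ((∅, {x}) : Finset ℕ × Finset ℕ)

/-- `Θ` is nontrivial: the identity `x = 0`, for a variable `x` of the second sort, is not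
fulfilled in `Θ`. -/
def IsNontrivialVariety : Prop :=
  ¬ ∀ H ∈ Θ, HoldsV H (Finsupp.single 0 1 : FreeVec k ℕ ℕ)

/-- `Θ` is action-type: `I_Θ(X₁) = 0` for all finite sets `X₁` of variables of the first sort. -/
def IsActionType : Prop :=
  ∀ X₁ : Finset ℕ, identIdeal (↥X₁) Θ = ⊥

end Category

/-!
Killing some of the variables of `X` and fixing the others gives an idempotent endomorphism of
`F_Θ(X)`, and distinct choices give distinct endomorphisms. Hence `F_Θ(X)` is nonzero with only
trivial idempotents exactly when `X` consists of one variable: in that case the component generated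
by it is a line, on which an idempotent acts by `0` or `1`. So `Φ` permutes the objects
isomorphic to some `F_Θ(x⁽¹⁾)` or `F_Θ(x⁽²⁾)`, and it remains to tell these two apart.

The homomorphism `x⁽¹⁾ ↦ ⁅x₀, x₁⁆` to the free representation `T` on two variables of the first sort
is nonzero, but every `T ⟶ F_Θ(x⁽¹⁾)` kills its image because the Lie algebra of `F_Θ(x⁽¹⁾)` is a
line; moreover `T` has no nonzero homomorphism to `F_Θ(x⁽²⁾)`. With the two sorts exchanged there is
no such `T`: an object without nonzero homomorphisms to `F_Θ(x⁽¹⁾)` has no variables of the first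
sort, so it is just a vector space, and on it the homomorphisms to `F_Θ(x⁽²⁾)`, which include the
coordinate functions, separate the points.
-/

attribute [local instance 100] LieRing.ofAssociativeRing

theorem apply_eq_zero_or_apply_eq_self_of_mem_span_singleton {R M F : Type*} [Ring R] [IsDomain R]
    [AddCommGroup M] [Module R M] [Module.IsTorsionFree R M] [FunLike F M M]
    [MulActionHomClass F R M M] {f : F} {v : M} (hv : f v ∈ Submodule.span R {v})
    (hf : f (f v) = f v) : f v = 0 ∨ f v = v := by
  obtain ⟨c, hc⟩ := Submodule.mem_span_singleton.1 hv
  have h : c • (f v - v) = 0 := by rw [smul_sub, ← map_smul, hc, hf, sub_self]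
  rcases smul_eq_zero.1 h with rfl | h
  · exact .inl (by rw [← hc, zero_smul])
  · exact .inr (sub_eq_zero.1 h)

section FreeAlgebras

variable {R X : Type*} [CommRing R]

theorem span_range_freeLieAlgebra_of [Subsingleton X] :
    Submodule.span R (Set.range (FreeLieAlgebra.of R : X → FreeLieAlgebra R X)) = ⊤ := by
  let S : LieSubalgebra R (FreeLieAlgebra R X) :=
    { Submodule.span R (Set.range (FreeLieAlgebra.of R)) with
      lie_mem' := LinearMap.BilinMap.apply_apply_mem_of_mem_span _ _ _
        (LieModule.toEnd R (FreeLieAlgebra R X) (FreeLieAlgebra R X)).toLinearMap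
        (by
          rintro _ ⟨x, rfl⟩ _ ⟨y, rfl⟩
          obtain rfl := Subsingleton.elim x y
          simp) _ _ }
  have retract : S.incl.comp (FreeLieAlgebra.lift R fun x =>
      ⟨FreeLieAlgebra.of R x, Submodule.subset_span (Set.mem_range_self x)⟩) = LieHom.id :=
    FreeLieAlgebra.hom_ext fun x => by simp
  refine eq_top_iff.2 fun l _ => ?_
  rw [← LieHom.id_apply (R := R) l, ← retract]
  exact Subtype.property _

theorem forall_hom_lie_of_eq_zero_iff_isLieAbelian {L : Type*} [LieRing L] [LieAlgebra R L]
    {x y : X} (hxy : x ≠ y) :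
    (∀ φ : FreeLieAlgebra R X →ₗ⁅R⁆ L, φ ⁅FreeLieAlgebra.of R x, FreeLieAlgebra.of R y⁆ = 0) ↔
      IsLieAbelian L := by
  classical
  refine ⟨fun h => ⟨fun l m => ?_⟩, fun _ φ => by rw [LieHom.map_lie, trivial_lie_zero]⟩
  simpa [hxy.symm] using h (FreeLieAlgebra.lift R fun z => if z = x then l else m)

theorem forall_hom_of_eq_zero_iff_subsingleton {L : Type*} [LieRing L] [LieAlgebra R L] (x : X) :
    (∀ φ : FreeLieAlgebra R X →ₗ⁅R⁆ L, φ (FreeLieAlgebra.of R x) = 0) ↔ Subsingleton L := by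
  refine ⟨fun h => subsingleton_of_forall_eq 0 fun l => ?_, fun _ φ => Subsingleton.elim _ _⟩
  simpa using h (FreeLieAlgebra.lift R fun _ => l)

theorem freeLieAlgebra_lie_of_ne_zero [Nontrivial R] {x y : X} (hxy : x ≠ y) :
    ⁅FreeLieAlgebra.of R x, FreeLieAlgebra.of R y⁆ ≠ 0 := fun h =>
  LieAlgebra.SpecialLinear.sl_non_abelian (Fin 2) R (by simp)
    ((forall_hom_lie_of_eq_zero_iff_isLieAbelian hxy).1 fun φ => by rw [h, map_zero])

theorem freeAlgebra_algebraMap_surjective [IsEmpty X] :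
    Function.Surjective (algebraMap R (FreeAlgebra R X)) := by
  rw [Algebra.surjective_algebraMap_iff, ← FreeAlgebra.adjoin_range_ι, Set.range_eq_empty,
    Algebra.adjoin_empty]

theorem span_range_finsupp_single_one {Y : Type*} [IsEmpty X] :
    Submodule.span R (Set.range fun y => (Finsupp.single y 1 : Y →₀ FreeAlgebra R X)) = ⊤ := by
  refine eq_top_iff.2 fun v _ => ?_
  induction v using Finsupp.induction_linear with
  | zero => exact zero_mem _
  | add v w hv hw => exact add_mem (hv trivial) (hw trivial)
  | single y a =>
    obtain ⟨c, rfl⟩ := freeAlgebra_algebraMap_surjective a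
    rw [Algebra.algebraMap_eq_smul_one, ← Finsupp.smul_single]
    exact Submodule.smul_mem _ c (Submodule.subset_span (Set.mem_range_self y))

end FreeAlgebras

namespace LieRepr

variable {k : Type u} [Field k] {H K M : LieRepr k}

instance : Limits.HasZeroMorphisms (LieRepr k) where
  zero H K := ⟨{ onL := 0, onV := 0, map_act := fun l v => by simp }⟩
  comp_zero _ _ := rfl
  zero_comp _ _ _ f :=
    Hom.ext (LieHom.ext fun _ => map_zero f.onL) (LinearMap.ext fun _ => map_zero f.onV)

theorem comp_onL (f : H ⟶ K) (g : K ⟶ M) (l : H.L) : (f ≫ g).onL l = g.onL (f.onL l) := rfl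

theorem comp_onV (f : H ⟶ K) (g : K ⟶ M) (v : H.V) : (f ≫ g).onV v = g.onV (f.onV v) := rfl

end LieRepr

namespace freeRepr

variable {k : Type u} [Field k] {X₁ X₂ : Type} {H : LieRepr k}

theorem freeLieToAssoc_of (x : X₁) :
    freeLieToAssoc k X₁ (FreeLieAlgebra.of k x) = FreeAlgebra.ι k x :=
  FreeLieAlgebra.lift_of_apply _ _

theorem lie_eq_smul (l : FreeLieAlgebra k X₁) (v : FreeVec k X₁ X₂) :
    ⁅l, v⁆ = freeLieToAssoc k X₁ l • v := rfl

/-- The action of the free associative algebra `A(X₁)` on the module of a representation `H` which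
a substitution of elements of the Lie algebra of `H` for the variables induces. -/
noncomputable def assocAction (f : X₁ → H.L) : FreeAlgebra k X₁ →ₐ[k] Module.End k H.V :=
  FreeAlgebra.lift k fun x => LieModule.toEnd k H.L H.V (f x)

theorem assocAction_ι (f : X₁ → H.L) (x : X₁) (v : H.V) :
    assocAction f (FreeAlgebra.ι k x) v = ⁅f x, v⁆ := by
  simp [assocAction]

theorem assocAction_freeLieToAssoc (f : X₁ → H.L) (l : FreeLieAlgebra k X₁) (v : H.V) :
    assocAction f (freeLieToAssoc k X₁ l) v = ⁅FreeLieAlgebra.lift k f l, v⁆ := by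
  have h : (assocAction f : FreeAlgebra k X₁ →ₗ⁅k⁆ Module.End k H.V).comp (freeLieToAssoc k X₁) =
      (LieModule.toEnd k H.L H.V).comp (FreeLieAlgebra.lift k f) :=
    FreeLieAlgebra.hom_ext fun x => by simp [assocAction, freeLieToAssoc_of]
  exact congr($h l v)

/-- The homomorphism `F(X) ⟶ H` which extends an assignment of values in `H` to the variables. -/
noncomputable def lift (f : X₁ → H.L) (g : X₂ → H.V) : freeRepr k X₁ X₂ ⟶ H where
  onL := FreeLieAlgebra.lift k f
  onV := Finsupp.lsum k fun y => (assocAction f).toLinearMap.flip (g y)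
  map_act l v := by
    change Finsupp.lsum k _ (freeLieToAssoc k X₁ l • v) = _
    induction v using Finsupp.induction_linear with
    | zero => simp
    | add v w hv hw => simp only [smul_add, map_add, lie_add, hv, hw]
    | single y a =>
      simp [Finsupp.smul_single, -Finsupp.single_mul, assocAction_freeLieToAssoc]

theorem lift_onL_of (f : X₁ → H.L) (g : X₂ → H.V) (x : X₁) :
    (lift f g).onL (FreeLieAlgebra.of k x) = f x :=
  FreeLieAlgebra.lift_of_apply f x

theorem lift_onV_single (f : X₁ → H.L) (g : X₂ → H.V) (y : X₂) :
    (lift f g).onV (Finsupp.single y 1 : FreeVec k X₁ X₂) = g y := by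
  simp [lift]

theorem onV_smul (μ : freeRepr k X₁ X₂ ⟶ H) (a : FreeAlgebra k X₁) (v : FreeVec k X₁ X₂) :
    μ.onV (a • v : FreeVec k X₁ X₂) =
      assocAction (fun x => μ.onL (FreeLieAlgebra.of k x)) a (μ.onV v) := by
  let onV : FreeVec k X₁ X₂ →ₗ[k] H.V := μ.onV
  change onV (a • v) = assocAction _ a (onV v)
  induction a using FreeAlgebra.induction generalizing v with
  | grade0 r => simp [algebraMap_smul]
  | grade1 x =>
    rw [assocAction_ι, ← μ.map_act, lie_eq_smul, freeLieToAssoc_of]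
  | mul a b ha hb => rw [mul_smul, ha, hb, map_mul, Module.End.mul_apply]
  | add a b ha hb => rw [add_smul, map_add, ha, hb, map_add, LinearMap.add_apply]

theorem hom_ext {μ ν : freeRepr k X₁ X₂ ⟶ H}
    (hL : ∀ x, μ.onL (FreeLieAlgebra.of k x) = ν.onL (FreeLieAlgebra.of k x))
    (hV : ∀ y, μ.onV (Finsupp.single y 1 : FreeVec k X₁ X₂) =
      ν.onV (Finsupp.single y 1 : FreeVec k X₁ X₂)) : μ = ν := by
  refine LieRepr.Hom.ext (FreeLieAlgebra.hom_ext hL) (Finsupp.lhom_ext fun y a => ?_)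
  have h : (Finsupp.single y a : FreeVec k X₁ X₂) = a • Finsupp.single y 1 := by simp
  rw [h]
  exact (onV_smul μ a _).trans (by rw [funext hL, hV]; exact (onV_smul ν a _).symm)

end freeRepr

theorem holdsV_single_iff_subsingleton {k : Type u} [Field k] {X₁ X₂ : Type} {H : LieRepr k}
    (y : X₂) : HoldsV H (Finsupp.single y 1 : FreeVec k X₁ X₂) ↔ Subsingleton H.V := by
  refine ⟨fun h => subsingleton_of_forall_eq 0 fun v => ?_, fun _ μ => Subsingleton.elim _ _⟩
  exact (freeRepr.lift_onV_single 0 (fun _ => v) y).symm.trans (h _)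

namespace relFreeRepr

variable {k : Type u} [Field k] {Θ : Set (LieRepr k)} {X₁ X₂ Y₁ Y₂ : Type}

variable (Θ X₁ X₂) in
/-- The natural projection `F(X) ⟶ F_Θ(X)`. -/
noncomputable def proj : freeRepr k X₁ X₂ ⟶ relFreeRepr X₁ X₂ Θ where
  onL := { LieSubmodule.Quotient.mk' (identIdeal X₁ Θ) with map_lie' := rfl }
  onV := LieSubmodule.Quotient.mk' (identSubmodule X₁ X₂ Θ)
  map_act _ _ := rfl

theorem proj_onL_surjective : Function.Surjective (proj Θ X₁ X₂).onL :=
  LieSubmodule.Quotient.surjective_mk' _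

theorem proj_onV_surjective : Function.Surjective (proj Θ X₁ X₂).onV :=
  LieSubmodule.Quotient.surjective_mk' _

theorem proj_onL_eq_zero_iff {l : FreeLieAlgebra k X₁} :
    (proj Θ X₁ X₂).onL l = 0 ↔ ∀ H ∈ Θ, HoldsL H l :=
  LieSubmodule.Quotient.mk_eq_zero' (N := identIdeal X₁ Θ)

theorem proj_onV_eq_zero_iff {v : FreeVec k X₁ X₂} :
    (proj Θ X₁ X₂).onV v = 0 ↔ ∀ H ∈ Θ, HoldsV H v :=
  LieSubmodule.Quotient.mk_eq_zero' (N := identSubmodule X₁ X₂ Θ)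

/-- The homomorphism `F_Θ(X) ⟶ H` induced by a homomorphism `F(X) ⟶ H` which kills the identities
of `Θ`. -/
noncomputable def desc {H : LieRepr k} (μ : freeRepr k X₁ X₂ ⟶ H)
    (hL : ∀ l ∈ identIdeal X₁ Θ, μ.onL l = 0) (hV : ∀ v ∈ identSubmodule X₁ X₂ Θ, μ.onV v = 0) :
    relFreeRepr X₁ X₂ Θ ⟶ H where
  onL :=
    { (identIdeal X₁ Θ).toSubmodule.liftQ (μ.onL : FreeLieAlgebra k X₁ →ₗ[k] H.L) hL with
      map_lie' := by
        rintro ⟨l⟩ ⟨m⟩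
        exact LieHom.map_lie μ.onL l m }
  onV := (identSubmodule X₁ X₂ Θ).toSubmodule.liftQ μ.onV hV
  map_act := by
    rintro ⟨l⟩ ⟨v⟩
    exact μ.map_act l v

theorem exists_comp_proj_eq (μ : freeRepr k X₁ X₂ ⟶ relFreeRepr Y₁ Y₂ Θ) :
    ∃ ν : freeRepr k X₁ X₂ ⟶ freeRepr k Y₁ Y₂, ν ≫ proj Θ Y₁ Y₂ = μ := by
  choose f hf using fun x => proj_onL_surjective (X₂ := Y₂) (μ.onL (FreeLieAlgebra.of k x))
  choose g hg using fun y => proj_onV_surjective (μ.onV (Finsupp.single y 1 : FreeVec k X₁ X₂))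
  refine ⟨freeRepr.lift f g, freeRepr.hom_ext (fun x => ?_) fun y => ?_⟩
  · rw [LieRepr.comp_onL, freeRepr.lift_onL_of, hf]
  · rw [LieRepr.comp_onV, ← hg]
    exact congrArg (proj Θ Y₁ Y₂).onV (freeRepr.lift_onV_single f g y)

theorem onL_eq_zero_of_mem_identIdeal (μ : freeRepr k X₁ X₂ ⟶ relFreeRepr Y₁ Y₂ Θ)
    {l : FreeLieAlgebra k X₁} (hl : l ∈ identIdeal X₁ Θ) : μ.onL l = 0 := by
  obtain ⟨ν, rfl⟩ := exists_comp_proj_eq μ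
  exact proj_onL_eq_zero_iff.2 fun H hH φ => hl H hH (φ.comp ν.onL)

theorem onV_eq_zero_of_mem_identSubmodule (μ : freeRepr k X₁ X₂ ⟶ relFreeRepr Y₁ Y₂ Θ)
    {v : FreeVec k X₁ X₂} (hv : v ∈ identSubmodule X₁ X₂ Θ) : μ.onV v = 0 := by
  obtain ⟨ν, rfl⟩ := exists_comp_proj_eq μ
  exact proj_onV_eq_zero_iff.2 fun H hH η => hv H hH (ν ≫ η)

variable (Θ X₂) in
/-- The generator of `F_Θ(X)` given by a variable of the first sort. -/
noncomputable def genL (x : X₁) : (relFreeRepr X₁ X₂ Θ).L :=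
  (proj Θ X₁ X₂).onL (FreeLieAlgebra.of k x)

variable (Θ X₁) in
/-- The generator of `F_Θ(X)` given by a variable of the second sort. -/
noncomputable def genV (y : X₂) : (relFreeRepr X₁ X₂ Θ).V :=
  (proj Θ X₁ X₂).onV (Finsupp.single y 1 : FreeVec k X₁ X₂)

theorem hom_ext {H : LieRepr k} {μ ν : relFreeRepr X₁ X₂ Θ ⟶ H}
    (hL : ∀ x, μ.onL (genL Θ X₂ x) = ν.onL (genL Θ X₂ x))
    (hV : ∀ y, μ.onV (genV Θ X₁ y) = ν.onV (genV Θ X₁ y)) : μ = ν := by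
  have h : proj Θ X₁ X₂ ≫ μ = proj Θ X₁ X₂ ≫ ν := freeRepr.hom_ext hL hV
  refine LieRepr.Hom.ext (LieHom.ext fun l => ?_) (LinearMap.ext fun v => ?_)
  · obtain ⟨l, rfl⟩ := proj_onL_surjective l
    exact congr(LieRepr.Hom.onL $h l)
  · obtain ⟨v, rfl⟩ := proj_onV_surjective v
    exact congr(LieRepr.Hom.onV $h v)

/-- The homomorphism `F_Θ(X) ⟶ F_Θ(Y)` which extends an assignment of values to the generators. -/
noncomputable def lift (f : X₁ → (relFreeRepr Y₁ Y₂ Θ).L) (g : X₂ → (relFreeRepr Y₁ Y₂ Θ).V) :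
    relFreeRepr X₁ X₂ Θ ⟶ relFreeRepr Y₁ Y₂ Θ :=
  desc (freeRepr.lift f g) (fun _ => onL_eq_zero_of_mem_identIdeal _)
    fun _ => onV_eq_zero_of_mem_identSubmodule _

theorem lift_onL_genL (f : X₁ → (relFreeRepr Y₁ Y₂ Θ).L)
    (g : X₂ → (relFreeRepr Y₁ Y₂ Θ).V) (x : X₁) : (lift f g).onL (genL Θ X₂ x) = f x :=
  freeRepr.lift_onL_of f g x

theorem lift_onV_genV (f : X₁ → (relFreeRepr Y₁ Y₂ Θ).L)
    (g : X₂ → (relFreeRepr Y₁ Y₂ Θ).V) (y : X₂) : (lift f g).onV (genV Θ X₁ y) = g y :=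
  freeRepr.lift_onV_single f g y

theorem genL_ne_zero (hL : ∃ H ∈ Θ, Nontrivial H.L) (x : X₁) : genL Θ X₂ x ≠ 0 := by
  obtain ⟨H, hH, _⟩ := hL
  exact fun h => not_subsingleton H.L
    ((forall_hom_of_eq_zero_iff_subsingleton x).1 (proj_onL_eq_zero_iff.1 h H hH))

theorem genV_ne_zero (hV : ∃ H ∈ Θ, Nontrivial H.V) (y : X₂) : genV Θ X₁ y ≠ 0 := by
  obtain ⟨H, hH, _⟩ := hV
  exact fun h => not_subsingleton H.V
    ((holdsV_single_iff_subsingleton y).1 (proj_onV_eq_zero_iff.1 h H hH))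

theorem lie_genL_ne_zero (hL : ∃ H ∈ Θ, ¬ IsLieAbelian H.L) {x y : X₁} (hxy : x ≠ y) :
    ⁅genL Θ X₂ x, genL Θ X₂ y⁆ ≠ 0 := by
  obtain ⟨H, hH, hab⟩ := hL
  rw [genL, genL, ← LieHom.map_lie]
  exact fun h => hab
    ((forall_hom_lie_of_eq_zero_iff_isLieAbelian hxy).1 (proj_onL_eq_zero_iff.1 h H hH))

theorem span_range_genL [Subsingleton X₁] :
    Submodule.span k (Set.range (genL Θ X₂ : X₁ → _)) = ⊤ := by
  let onL : FreeLieAlgebra k X₁ →ₗ[k] (relFreeRepr X₁ X₂ Θ).L := (proj Θ X₁ X₂).onL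
  have h := congrArg (Submodule.map onL) span_range_freeLieAlgebra_of
  rwa [Submodule.map_span, ← Set.range_comp, Submodule.map_top,
    LinearMap.range_eq_top.2 proj_onL_surjective] at h

theorem span_range_genV [IsEmpty X₁] :
    Submodule.span k (Set.range (genV Θ X₁ : X₂ → _)) = ⊤ := by
  have h := congrArg (Submodule.map (proj Θ X₁ X₂).onV) span_range_finsupp_single_one
  rwa [Submodule.map_span, ← Set.range_comp, Submodule.map_top,
    LinearMap.range_eq_top.2 proj_onV_surjective] at h

variable (Θ) in
/-- The isomorphism of free representations given by renaming the variables. -/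
noncomputable def mapIso (e₁ : X₁ ≃ Y₁) (e₂ : X₂ ≃ Y₂) :
    relFreeRepr X₁ X₂ Θ ≅ relFreeRepr Y₁ Y₂ Θ where
  hom := lift (fun x => genL Θ Y₂ (e₁ x)) fun y => genV Θ Y₁ (e₂ y)
  inv := lift (fun x => genL Θ X₂ (e₁.symm x)) fun y => genV Θ X₁ (e₂.symm y)
  hom_inv_id := hom_ext
    (fun _ => by rw [LieRepr.comp_onL, lift_onL_genL, lift_onL_genL, e₁.symm_apply_apply]; rfl)
    (fun _ => by rw [LieRepr.comp_onV, lift_onV_genV, lift_onV_genV, e₂.symm_apply_apply]; rfl)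
  inv_hom_id := hom_ext
    (fun _ => by rw [LieRepr.comp_onL, lift_onL_genL, lift_onL_genL, e₁.apply_symm_apply]; rfl)
    (fun _ => by rw [LieRepr.comp_onV, lift_onV_genV, lift_onV_genV, e₂.apply_symm_apply]; rfl)

variable (Θ) in
/-- The idempotent endomorphism of `F_Θ(X)` which fixes the generators in `S` and kills the
others. -/
noncomputable def restrict (S : Set (X₁ ⊕ X₂)) : relFreeRepr X₁ X₂ Θ ⟶ relFreeRepr X₁ X₂ Θ :=
  lift ((Sum.inl ⁻¹' S).indicator (genL Θ X₂)) ((Sum.inr ⁻¹' S).indicator (genV Θ X₁))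

theorem restrict_onL_genL (S : Set (X₁ ⊕ X₂)) (x : X₁) :
    (restrict Θ S).onL (genL Θ X₂ x) = (Sum.inl ⁻¹' S).indicator (genL Θ X₂) x :=
  lift_onL_genL _ _ x

theorem restrict_onV_genV (S : Set (X₁ ⊕ X₂)) (y : X₂) :
    (restrict Θ S).onV (genV Θ X₁ y) = (Sum.inr ⁻¹' S).indicator (genV Θ X₁) y :=
  lift_onV_genV _ _ y

theorem restrict_comp_restrict (S : Set (X₁ ⊕ X₂)) :
    restrict Θ S ≫ restrict Θ S = restrict Θ S := by
  refine hom_ext (fun x => ?_) fun y => ?_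
  · rw [LieRepr.comp_onL, restrict_onL_genL]
    by_cases hx : x ∈ Sum.inl ⁻¹' S
    · rw [Set.indicator_of_mem hx, restrict_onL_genL, Set.indicator_of_mem hx]
    · rw [Set.indicator_of_notMem hx, map_zero]
  · rw [LieRepr.comp_onV, restrict_onV_genV]
    by_cases hy : y ∈ Sum.inr ⁻¹' S
    · rw [Set.indicator_of_mem hy, restrict_onV_genV, Set.indicator_of_mem hy]
    · rw [Set.indicator_of_notMem hy, map_zero]

theorem restrict_empty : restrict Θ (∅ : Set (X₁ ⊕ X₂)) = 0 :=
  hom_ext (fun x => by rw [restrict_onL_genL, Set.preimage_empty, Set.indicator_empty]; rfl)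
    (fun y => by rw [restrict_onV_genV, Set.preimage_empty, Set.indicator_empty]; rfl)

theorem restrict_univ : restrict Θ (Set.univ : Set (X₁ ⊕ X₂)) = 𝟙 _ :=
  hom_ext (fun x => by rw [restrict_onL_genL, Set.preimage_univ, Set.indicator_univ]; rfl)
    (fun y => by rw [restrict_onV_genV, Set.preimage_univ, Set.indicator_univ]; rfl)

theorem restrict_injective (hL : ∃ H ∈ Θ, Nontrivial H.L) (hV : ∃ H ∈ Θ, Nontrivial H.V) :
    Function.Injective (restrict Θ : Set (X₁ ⊕ X₂) → _) := by
  have fixes_genL_iff (S : Set (X₁ ⊕ X₂)) (x : X₁) :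
      (restrict Θ S).onL (genL Θ X₂ x) = genL Θ X₂ x ↔ .inl x ∈ S := by
    rw [restrict_onL_genL, Set.indicator_apply_eq_self, not_imp_comm]
    exact forall_prop_of_true (genL_ne_zero hL x)
  have fixes_genV_iff (S : Set (X₁ ⊕ X₂)) (y : X₂) :
      (restrict Θ S).onV (genV Θ X₁ y) = genV Θ X₁ y ↔ .inr y ∈ S := by
    rw [restrict_onV_genV, Set.indicator_apply_eq_self, not_imp_comm]
    exact forall_prop_of_true (genV_ne_zero hV y)
  intro S T h
  ext (x | y)
  · rw [← fixes_genL_iff, h, fixes_genL_iff]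
  · rw [← fixes_genV_iff, h, fixes_genV_iff]

end relFreeRepr

section Categorical

open Limits

variable {C D : Type*} [Category* C] [Category* D] [HasZeroMorphisms C] [HasZeroMorphisms D]

/-- `X` is nonzero and its only idempotent endomorphisms are zero and the identity. This is the
categorical description of the free representations on one variable. -/
def HasTrivialIdempotents (X : C) : Prop :=
  𝟙 X ≠ 0 ∧ ∀ e : X ⟶ X, e ≫ e = e → e = 0 ∨ e = 𝟙 X

/-- There are an object `T` without nonzero morphisms to `B` and a nonzero morphism `A ⟶ T` which
is killed by all morphisms `T ⟶ A`. Fully faithful functors preserve this relation, which tells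
apart the free representations on one variable of either sort. -/
def HasInvisibleMorphism (A B : C) : Prop :=
  ∃ (T : C) (f : A ⟶ T), f ≠ 0 ∧ (∀ g : T ⟶ A, f ≫ g = 0) ∧ ∀ h : T ⟶ B, h = 0

variable (F : C ⥤ D) [F.Full] [F.Faithful]

theorem hasTrivialIdempotents_obj_iff {X : C} :
    HasTrivialIdempotents (F.obj X) ↔ HasTrivialIdempotents X := by
  unfold HasTrivialIdempotents
  rw [F.map_surjective.forall]
  simp only [← F.map_comp, ← F.map_id, F.map_injective.eq_iff, F.map_eq_zero_iff, ne_eq]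

theorem HasInvisibleMorphism.map {A B : C} (h : HasInvisibleMorphism A B) :
    HasInvisibleMorphism (F.obj A) (F.obj B) := by
  obtain ⟨T, f, hf, hg, hB⟩ := h
  refine ⟨F.obj T, F.map f, (F.map_eq_zero_iff).not.2 hf, ?_, ?_⟩
  · exact F.map_surjective.forall.2 fun g => by rw [← F.map_comp, hg, F.map_zero]
  · exact F.map_surjective.forall.2 fun g => by rw [hB g, F.map_zero]

end Categorical

namespace relFreeRepr

variable {k : Type u} [Field k] {Θ : Set (LieRepr k)} {X₁ X₂ Y₁ Y₂ : Type}

theorem hasTrivialIdempotents_of_unique_of_isEmpty [Unique X₁] [IsEmpty X₂]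
    (h : 𝟙 (relFreeRepr X₁ X₂ Θ) ≠ 0) : HasTrivialIdempotents (relFreeRepr X₁ X₂ Θ) := by
  refine ⟨h, fun e he => ?_⟩
  have hspan : e.onL (genL Θ X₂ default) ∈ Submodule.span k {genL Θ X₂ default} := by
    rw [← Set.range_unique, span_range_genL]
    trivial
  exact (apply_eq_zero_or_apply_eq_self_of_mem_span_singleton hspan
    congr(LieRepr.Hom.onL $he _)).imp
    (fun h0 => hom_ext (Unique.forall_iff.2 h0) isEmptyElim)
    (fun h1 => hom_ext (Unique.forall_iff.2 h1) isEmptyElim)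

theorem hasTrivialIdempotents_of_isEmpty_of_unique [IsEmpty X₁] [Unique X₂]
    (h : 𝟙 (relFreeRepr X₁ X₂ Θ) ≠ 0) : HasTrivialIdempotents (relFreeRepr X₁ X₂ Θ) := by
  refine ⟨h, fun e he => ?_⟩
  have hspan : e.onV (genV Θ X₁ default) ∈ Submodule.span k {genV Θ X₁ default} := by
    rw [← Set.range_unique, span_range_genV]
    trivial
  exact (apply_eq_zero_or_apply_eq_self_of_mem_span_singleton hspan
    congr(LieRepr.Hom.onV $he _)).imp
    (fun h0 => hom_ext isEmptyElim (Unique.forall_iff.2 h0))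
    (fun h1 => hom_ext isEmptyElim (Unique.forall_iff.2 h1))

theorem nonempty_unique_of_hasTrivialIdempotents (hL : ∃ H ∈ Θ, Nontrivial H.L)
    (hV : ∃ H ∈ Θ, Nontrivial H.V) (h : HasTrivialIdempotents (relFreeRepr X₁ X₂ Θ)) :
    Nonempty (Unique (X₁ ⊕ X₂)) := by
  have eq_empty_or_eq_univ (S : Set (X₁ ⊕ X₂)) : S = ∅ ∨ S = Set.univ :=
    (h.2 _ (restrict_comp_restrict S)).imp
      (fun h0 => restrict_injective hL hV (h0.trans restrict_empty.symm))
      (fun h1 => restrict_injective hL hV (h1.trans restrict_univ.symm))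
  have not_isEmpty : ¬ IsEmpty (X₁ ⊕ X₂) := fun he =>
    h.1 (by rw [← restrict_univ, Set.univ_eq_empty_iff.2 he, restrict_empty])
  obtain ⟨z⟩ := not_isEmpty_iff.1 not_isEmpty
  refine ⟨⟨⟨z⟩, fun w => ?_⟩⟩
  have hz : ({z} : Set (X₁ ⊕ X₂)) = Set.univ :=
    (eq_empty_or_eq_univ {z}).resolve_left (Set.singleton_ne_empty z)
  exact hz.ge (Set.mem_univ w)

theorem isLieAbelian_of_subsingleton [Subsingleton X₁] :
    IsLieAbelian (relFreeRepr X₁ X₂ Θ).L where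
  trivial l m := by
    have h := LinearMap.BilinMap.apply_apply_mem_of_mem_span ⊥
      (Set.range (genL Θ X₂)) (Set.range (genL Θ X₂))
      (LieModule.toEnd k (relFreeRepr X₁ X₂ Θ).L (relFreeRepr X₁ X₂ Θ).L).toLinearMap
      (by
        rintro _ ⟨x, rfl⟩ _ ⟨y, rfl⟩
        obtain rfl := Subsingleton.elim x y
        exact lie_self (genL Θ X₂ x)) l m
    rw [span_range_genL] at h
    exact h trivial trivial

theorem subsingleton_L_of_isEmpty [IsEmpty X₁] : Subsingleton (relFreeRepr X₁ X₂ Θ).L := by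
  have h : Submodule.span k (Set.range (genL Θ X₂ : X₁ → _)) = ⊤ := span_range_genL
  rw [Set.range_eq_empty, Submodule.span_empty] at h
  exact (Submodule.subsingleton_iff k).1 (subsingleton_iff_bot_eq_top.1 h)

theorem hom_eq_zero_of_isEmpty [IsEmpty X₂] [IsEmpty Y₁]
    (μ : relFreeRepr X₁ X₂ Θ ⟶ relFreeRepr Y₁ Y₂ Θ) : μ = 0 :=
  hom_ext (fun _ => (subsingleton_L_of_isEmpty (X₁ := Y₁) (X₂ := Y₂)).elim _ _) isEmptyElim

theorem eq_zero_of_forall_onV_eq_zero [IsEmpty X₁] {v : (relFreeRepr X₁ X₂ Θ).V}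
    {w : (relFreeRepr Y₁ Y₂ Θ).V} (hw : w ≠ 0)
    (hv : ∀ μ : relFreeRepr X₁ X₂ Θ ⟶ relFreeRepr Y₁ Y₂ Θ, μ.onV v = 0) : v = 0 := by
  classical
  have hmem : v ∈ Submodule.span k (Set.range (genV Θ X₁)) := by
    rw [span_range_genV]
    trivial
  rw [← Finsupp.range_linearCombination] at hmem
  obtain ⟨c, rfl⟩ := hmem
  have coeff_eq_zero (y : X₂) : c y = 0 := by
    let μ : relFreeRepr X₁ X₂ Θ ⟶ relFreeRepr Y₁ Y₂ Θ := lift isEmptyElim (Pi.single y w)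
    have hμ : μ.onV ∘ genV Θ X₁ = Pi.single y w := funext (lift_onV_genV _ _)
    have h := hv μ
    rw [Finsupp.apply_linearCombination, hμ,
      Finsupp.linearCombination_single_index] at h
    exact (smul_eq_zero.1 h).resolve_right hw
  rw [show c = 0 from Finsupp.ext coeff_eq_zero, map_zero]

end relFreeRepr

section Varieties

variable {k : Type u} [Field k] {Θ : Set (LieRepr k)}

theorem exists_nontrivial_of_exists_not_isLieAbelian (hL : ∃ H ∈ Θ, ¬ IsLieAbelian H.L) :
    ∃ H ∈ Θ, Nontrivial H.L := by
  obtain ⟨H, hH, hab⟩ := hL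
  exact ⟨H, hH, not_subsingleton_iff_nontrivial.1 fun _ => hab inferInstance⟩

theorem IsActionType.exists_not_isLieAbelian (hact : IsActionType Θ) :
    ∃ H ∈ Θ, ¬ IsLieAbelian H.L := by
  by_contra! hab
  let x₀ : ({0, 1} : Finset ℕ) := ⟨0, by simp⟩
  let x₁ : ({0, 1} : Finset ℕ) := ⟨1, by simp⟩
  have hne : x₀ ≠ x₁ := by simp [x₀, x₁]
  have hmem : ⁅FreeLieAlgebra.of k x₀, FreeLieAlgebra.of k x₁⁆ ∈ identIdeal _ Θ := fun H hH =>
    (forall_hom_lie_of_eq_zero_iff_isLieAbelian hne).2 (hab H hH)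
  rw [hact, LieSubmodule.mem_bot] at hmem
  exact freeLieAlgebra_lie_of_ne_zero hne hmem

theorem IsNontrivialVariety.exists_nontrivial (hnt : IsNontrivialVariety Θ) :
    ∃ H ∈ Θ, Nontrivial H.V := by
  by_contra! h
  exact hnt fun H hH => (holdsV_single_iff_subsingleton 0).2 (h H hH)

end Varieties

namespace FreeCat

variable {k : Type u} [Field k] {Θ : Set (LieRepr k)}

noncomputable instance : Limits.HasZeroMorphisms (FreeCat Θ) :=
  (fullyFaithfulInducedFunctor _).hasZeroMorphisms

instance (x : ℕ) : Unique (freeOnL Θ x).1 := inferInstanceAs (Unique ({x} : Finset ℕ))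

instance (x : ℕ) : IsEmpty (freeOnL Θ x).2 := inferInstanceAs (IsEmpty (∅ : Finset ℕ))

instance (y : ℕ) : IsEmpty (freeOnV Θ y).1 := inferInstanceAs (IsEmpty (∅ : Finset ℕ))

instance (y : ℕ) : Unique (freeOnV Θ y).2 := inferInstanceAs (Unique ({y} : Finset ℕ))

theorem hom_eq_zero_iff {X Y : FreeCat Θ} {f : X ⟶ Y} : f = 0 ↔ f.hom = 0 :=
  InducedCategory.hom_ext_iff

theorem hasTrivialIdempotents_iff {X : FreeCat Θ} :
    HasTrivialIdempotents X ↔ HasTrivialIdempotents (relFreeRepr X.1 X.2 Θ) :=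
  (hasTrivialIdempotents_obj_iff (C := FreeCat Θ) (inducedFunctor _) (X := X)).symm

theorem hasTrivialIdempotents_freeOnL (hL : ∃ H ∈ Θ, Nontrivial H.L) (x : ℕ) :
    HasTrivialIdempotents (freeOnL Θ x) :=
  hasTrivialIdempotents_iff.2 <| relFreeRepr.hasTrivialIdempotents_of_unique_of_isEmpty fun h =>
    relFreeRepr.genL_ne_zero hL _ congr(LieRepr.Hom.onL $h (relFreeRepr.genL Θ _ default))

theorem hasTrivialIdempotents_freeOnV (hV : ∃ H ∈ Θ, Nontrivial H.V) (y : ℕ) :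
    HasTrivialIdempotents (freeOnV Θ y) :=
  hasTrivialIdempotents_iff.2 <| relFreeRepr.hasTrivialIdempotents_of_isEmpty_of_unique fun h =>
    relFreeRepr.genV_ne_zero hV _ congr(LieRepr.Hom.onV $h (relFreeRepr.genV Θ _ default))

theorem eq_freeOnL_or_eq_freeOnV (hL : ∃ H ∈ Θ, Nontrivial H.L)
    (hV : ∃ H ∈ Θ, Nontrivial H.V) {X : FreeCat Θ} (h : HasTrivialIdempotents X) :
    (∃ a, X = freeOnL Θ a) ∨ ∃ b, X = freeOnV Θ b := by
  obtain ⟨s, t⟩ := X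
  have hcard := Fintype.card_eq_one_iff_nonempty_unique.2
    (relFreeRepr.nonempty_unique_of_hasTrivialIdempotents hL hV (hasTrivialIdempotents_iff.1 h))
  rw [Fintype.card_sum, Fintype.card_coe, Fintype.card_coe, Nat.add_eq_one_iff,
    Finset.card_eq_zero, Finset.card_eq_zero, Finset.card_eq_one, Finset.card_eq_one] at hcard
  rcases hcard with ⟨rfl, b, rfl⟩ | ⟨⟨a, rfl⟩, rfl⟩
  · exact .inr ⟨b, rfl⟩
  · exact .inl ⟨a, rfl⟩

theorem nonempty_iso_freeOnL (a b : ℕ) : Nonempty (freeOnL Θ a ≅ freeOnL Θ b) :=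
  ⟨InducedCategory.isoMk
    (relFreeRepr.mapIso Θ (.ofUnique (freeOnL Θ a).1 (freeOnL Θ b).1) (.refl _))⟩

theorem nonempty_iso_freeOnV (a b : ℕ) : Nonempty (freeOnV Θ a ≅ freeOnV Θ b) :=
  ⟨InducedCategory.isoMk
    (relFreeRepr.mapIso Θ (.refl _) (.ofUnique (freeOnV Θ a).2 (freeOnV Θ b).2))⟩

theorem to_freeOnV_eq_zero {X : FreeCat Θ} [IsEmpty X.2] {y : ℕ} (f : X ⟶ freeOnV Θ y) :
    f = 0 :=
  hom_eq_zero_iff.2 (relFreeRepr.hom_eq_zero_of_isEmpty _)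

theorem isEmpty_iso_freeOnL_freeOnV (hL : ∃ H ∈ Θ, Nontrivial H.L) (x y : ℕ) :
    IsEmpty (freeOnL Θ x ≅ freeOnV Θ y) where
  false i := (hasTrivialIdempotents_freeOnL hL x).1 <| by
    rw [← i.hom_inv_id, to_freeOnV_eq_zero i.hom, Limits.zero_comp]

theorem hasInvisibleMorphism_freeOnL_freeOnV (hL : ∃ H ∈ Θ, ¬ IsLieAbelian H.L) (x y : ℕ) :
    HasInvisibleMorphism (freeOnL Θ x) (freeOnV Θ y) := by
  let T : FreeCat Θ := (({0, 1} : Finset ℕ), (∅ : Finset ℕ))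
  have : IsEmpty T.2 := inferInstanceAs (IsEmpty (∅ : Finset ℕ))
  let x₀ : T.1 := ⟨0, by simp [T]⟩
  let x₁ : T.1 := ⟨1, by simp [T]⟩
  let c := ⁅relFreeRepr.genL Θ T.2 x₀, relFreeRepr.genL Θ T.2 x₁⁆
  have c_ne_zero : c ≠ 0 := relFreeRepr.lie_genL_ne_zero hL (by simp [x₀, x₁])
  let f : freeOnL Θ x ⟶ T := InducedCategory.homMk (relFreeRepr.lift (fun _ => c) 0)
  have f_genL (z) : f.hom.onL (relFreeRepr.genL Θ _ z) = c := relFreeRepr.lift_onL_genL _ _ z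
  refine ⟨T, f, fun hf => c_ne_zero ?_, fun g => ?_, to_freeOnV_eq_zero⟩
  · rw [← f_genL default, hf]
    rfl
  · have : IsLieAbelian (relFreeRepr (freeOnL Θ x).1 (freeOnL Θ x).2 Θ).L :=
      relFreeRepr.isLieAbelian_of_subsingleton (X₂ := (freeOnL Θ x).2)
    refine hom_eq_zero_iff.2 (relFreeRepr.hom_ext (fun z => ?_) isEmptyElim)
    change g.hom.onL (f.hom.onL _) = 0
    rw [f_genL, LieHom.map_lie, trivial_lie_zero]

theorem isEmpty_of_forall_to_freeOnL_eq_zero (hL : ∃ H ∈ Θ, Nontrivial H.L) {X : FreeCat Θ} {x : ℕ}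
    (hX : ∀ f : X ⟶ freeOnL Θ x, f = 0) : IsEmpty X.1 where
  false a := by
    let z := relFreeRepr.genL Θ (freeOnL Θ x).2 (default : (freeOnL Θ x).1)
    let f : X ⟶ freeOnL Θ x := InducedCategory.homMk (relFreeRepr.lift (fun _ => z) 0)
    have f_genL : f.hom.onL (relFreeRepr.genL Θ X.2 a) = z := relFreeRepr.lift_onL_genL _ _ a
    refine relFreeRepr.genL_ne_zero hL _ (f_genL.symm.trans ?_)
    rw [hX f]
    rfl

theorem not_hasInvisibleMorphism_freeOnV_freeOnL (hL : ∃ H ∈ Θ, Nontrivial H.L)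
    (hV : ∃ H ∈ Θ, Nontrivial H.V) (x y : ℕ) :
    ¬ HasInvisibleMorphism (freeOnV Θ y) (freeOnL Θ x) := by
  rintro ⟨T, f, hf, hg, hT⟩
  have := isEmpty_of_forall_to_freeOnL_eq_zero hL hT
  refine hf (hom_eq_zero_iff.2 (relFreeRepr.hom_ext isEmptyElim fun z => ?_))
  have hz : relFreeRepr.genV Θ (freeOnV Θ y).1 z ≠ 0 := relFreeRepr.genV_ne_zero hV z
  exact relFreeRepr.eq_zero_of_forall_onV_eq_zero hz fun μ =>
    congr(LieRepr.Hom.onV (InducedCategory.Hom.hom $(hg (InducedCategory.homMk μ))) _)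

variable (F : FreeCat Θ ⥤ FreeCat Θ) [F.Full] [F.Faithful]

theorem exists_obj_freeOnL_eq (hL : ∃ H ∈ Θ, ¬ IsLieAbelian H.L) (hV : ∃ H ∈ Θ, Nontrivial H.V)
    (x : ℕ) : ∃ a, F.obj (freeOnL Θ x) = freeOnL Θ a := by
  have hL' := exists_nontrivial_of_exists_not_isLieAbelian hL
  refine (eq_freeOnL_or_eq_freeOnV hL' hV ((hasTrivialIdempotents_obj_iff F).2
    (hasTrivialIdempotents_freeOnL hL' x))).resolve_right ?_
  rintro ⟨a, ha⟩
  rcases eq_freeOnL_or_eq_freeOnV hL' hV ((hasTrivialIdempotents_obj_iff F).2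
    (hasTrivialIdempotents_freeOnV hV x)) with ⟨b, hb⟩ | ⟨b, hb⟩
  · have h := (hasInvisibleMorphism_freeOnL_freeOnV hL x x).map F
    rw [ha, hb] at h
    exact not_hasInvisibleMorphism_freeOnV_freeOnL hL' hV _ _ h
  · obtain ⟨i⟩ := nonempty_iso_freeOnV (Θ := Θ) a b
    exact (isEmpty_iso_freeOnL_freeOnV hL' x x).false
      (F.preimageIso (eqToIso ha ≪≫ i ≪≫ eqToIso hb.symm))

theorem exists_obj_freeOnV_eq (hL : ∃ H ∈ Θ, ¬ IsLieAbelian H.L) (hV : ∃ H ∈ Θ, Nontrivial H.V)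
    (y : ℕ) : ∃ b, F.obj (freeOnV Θ y) = freeOnV Θ b := by
  have hL' := exists_nontrivial_of_exists_not_isLieAbelian hL
  refine (eq_freeOnL_or_eq_freeOnV hL' hV ((hasTrivialIdempotents_obj_iff F).2
    (hasTrivialIdempotents_freeOnV hV y))).resolve_left ?_
  rintro ⟨b, hb⟩
  obtain ⟨a, ha⟩ := exists_obj_freeOnL_eq F hL hV y
  obtain ⟨i⟩ := nonempty_iso_freeOnL (Θ := Θ) a b
  exact (isEmpty_iso_freeOnL_freeOnV hL' y y).false
    (F.preimageIso (eqToIso ha ≪≫ i ≪≫ eqToIso hb.symm))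

end FreeCat

theorem mainTheorem5_general {k : Type u} [Field k] (Θ : Set (LieRepr k))
    (hL : ∃ H ∈ Θ, ¬ IsLieAbelian H.L) (hV : ∃ H ∈ Θ, Nontrivial H.V)
    (F : FreeCat Θ ⥤ FreeCat Θ) [F.Full] [F.Faithful] :
    (∀ x : ℕ, Nonempty (F.obj (freeOnL Θ x) ≅ freeOnL Θ x)) ∧
    (∀ x : ℕ, Nonempty (F.obj (freeOnV Θ x) ≅ freeOnV Θ x)) ∧
    (∀ x y : ℕ, IsEmpty (F.obj (freeOnL Θ x) ≅ freeOnV Θ y) ∧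
      IsEmpty (F.obj (freeOnV Θ y) ≅ freeOnL Θ x)) := by
  have not_iso := FreeCat.isEmpty_iso_freeOnL_freeOnV
    (exists_nontrivial_of_exists_not_isLieAbelian hL)
  refine ⟨fun x => ?_, fun y => ?_, fun x y => ⟨?_, ?_⟩⟩
  · obtain ⟨a, ha⟩ := FreeCat.exists_obj_freeOnL_eq F hL hV x
    exact ha ▸ FreeCat.nonempty_iso_freeOnL a x
  · obtain ⟨b, hb⟩ := FreeCat.exists_obj_freeOnV_eq F hL hV y
    exact hb ▸ FreeCat.nonempty_iso_freeOnV b y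
  · obtain ⟨a, ha⟩ := FreeCat.exists_obj_freeOnL_eq F hL hV x
    exact ha ▸ not_iso a y
  · obtain ⟨b, hb⟩ := FreeCat.exists_obj_freeOnV_eq F hL hV y
    exact ⟨fun i => (not_iso x b).false (i.symm ≪≫ eqToIso hb)⟩

theorem mainTheorem5 {k : Type u} [Field k] [CharZero k] (Θ : Set (LieRepr k))
    (hΘ : IsVariety Θ) (hact : IsActionType Θ) (hnt : IsNontrivialVariety Θ)
    (Φ : Aut (Cat.of (FreeCat Θ))) :
    (∀ x : ℕ, Nonempty (Φ.hom.toFunctor.obj (freeOnL Θ x) ≅ freeOnL Θ x)) ∧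
    (∀ x : ℕ, Nonempty (Φ.hom.toFunctor.obj (freeOnV Θ x) ≅ freeOnV Θ x)) ∧
    (∀ x y : ℕ, IsEmpty (Φ.hom.toFunctor.obj (freeOnL Θ x) ≅ freeOnV Θ y) ∧
      IsEmpty (Φ.hom.toFunctor.obj (freeOnV Θ y) ≅ freeOnL Θ x)) :=
  let e : FreeCat Θ ≌ FreeCat Θ := Cat.equivOfIso Φ
  mainTheorem5_general Θ hact.exists_not_isLieAbelian hnt.exists_nontrivial e.functor
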